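/- Let $m \ge 5$ be odd, and let $C_m \subseteq \mathrm{GF}(2)^{2^m-1}$ be a binary linear code of length $2^m-1$ whose dual code $C_m^\perp$ has the following weight distribution: $1$ codeword of weight $0$; $(2^m-1)(2^{(m-1)/2}+1)2^{(m-3)/2}$ codewords of weight $2^{m-1}-2^{(m-1)/2}$; $(2^m-1)(2^{m-1}+1)$ codewords of weight $2^{m-1}$; $(2^m-1)(2^{(m-1)/2}-1)2^{(m-3)/2}$ codewords of weight $2^{m-1}+2^{(m-1)/2}$; and no codewords of any other weight. Let $\overline{C}_m$ be the extended code of $C_m$ (of length $2^m$, obtained by appending to every codeword an overall parity bit), and let $\overline{C}_m^\perp$ be its dual. Write $\overline{A}_k$ and $\overline{A}_k^\perp$ for the numbers of codewords of Hamming weight $k$ in $\overline{C}_m$ and in $\overline{C}_m^\perp$. Put $u = 2^{2m-1}-2^{m-1}$ and $v = 2^{2m}+2^m-2$. A $t$-$(n,k,\lambda)$ design, with $1 \le t \le k \le n$, is a set of $k$-subsets (blocks) of an $n$-set of points such that every $t$-subset of the points is contained in exactly $\lambda$ blocks. (a) For every $k \ge 1$ with $\overline{A}_k \ne 0$, the supports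 of the codewords of weight $k$ in $\overline{C}_m$ are the blocks of a $3$-$(2^m,k,\lambda)$ design on the set of the $2^m$ coordinate positions, where $$\lambda = \frac{\overline{A}_k\binom{k}{3}}{\binom{2^m}{3}}.$$ Here, for $0 \le k \le 2^m$, $$\begin{aligned}2^{2m+1}\,\overline{A}_k ={}& \bigl(1+(-1)^k\bigr)\binom{2^m}{k} + \frac{1+(-1)^k}{2}(-1)^{\lfloor k/2\rfloor}\binom{2^{m-1}}{\lfloor k/2\rfloor}\,v\\ &+ u\sum_{\substack{0\le i\le 2^{m-1}-2^{(m-1)/2}\\ 0\le j\le 2^{m-1}+2^{(m-1)/2}\\ i+j=k}}(-1)^i\binom{2^{m-1}-2^{(m-1)/2}}{i}\binom{2^{m-1}+2^{(m-1)/2}}{j}\\ &+ u\sum_{\substack{0\le i\le 2^{m-1}+2^{(m-1)/2}\\ 0\le j\le 2^{m-1}-2^{(m-1)/2}\\ i+j=k}}(-1)^i\binom{2^{m-1}+2^{(m-1)/2}}{i}\binom{2^{m-1}-2^{(m-1)/2}}{j}.\end{aligned}$$ (b) For every $k \ge 1$ with $\overline{A}_k^\perp \ne 0$, the supports of the codewords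 of weight $k$ in $\overline{C}_m^\perp$ are the blocks of a $3$-$(2^m,k,\lambda)$ design on the set of the $2^m$ coordinate positions, where $$\lambda = \frac{\overline{A}_k^\perp\binom{k}{3}}{\binom{2^m}{3}}.$$ Here the weight enumerator of $\overline{C}_m^\perp$ is $$\sum_{k=0}^{2^m}\overline{A}_k^\perp z^k = 1+u z^{2^{m-1}-2^{(m-1)/2}}+v z^{2^{m-1}}+u z^{2^{m-1}+2^{(m-1)/2}}+z^{2^m}.$$ -/

import Mathlib

/-- The support of a word: the set of coordinates at which it does not vanish. -/
def codewordSupport {F ι : Type*} [Zero F] [DecidableEq F] [Fintype ι] (x : ι → F) : Finset ι :=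
  Finset.univ.filter fun i => x i ≠ 0

/-- The dual of a linear code, with respect to the standard inner product. -/
def dualCode {F ι : Type*} [Field F] [Fintype ι] (C : Submodule F (ι → F)) :
    Submodule F (ι → F) where
  carrier := {x | ∀ c ∈ C, ∑ i, x i * c i = 0}
  add_mem' := by
    intro a b ha hb c hc
    simp [add_mul, Finset.sum_add_distrib, ha c hc, hb c hc]
  zero_mem' := by
    intro c _
    simp
  smul_mem' := by
    intro r x hx c hc
    simp [mul_assoc, ← Finset.mul_sum, hx c hc]

/-- The extended code: every codeword is extended by one last coordinate, chosen so that the sum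
of all the coordinates is zero. -/
def extendedCode {F : Type*} [Field F] {n : ℕ} (C : Submodule F (Fin n → F)) :
    Submodule F (Fin (n + 1) → F) where
  carrier := {x | (fun i : Fin n => x i.castSucc) ∈ C ∧ ∑ i, x i = 0}
  add_mem' := by
    rintro a b ⟨ha, ha'⟩ ⟨hb, hb'⟩
    refine ⟨C.add_mem ha hb, ?_⟩
    simp [Finset.sum_add_distrib, ha', hb']
  zero_mem' := ⟨C.zero_mem, by simp⟩
  smul_mem' := by
    rintro r x ⟨hx, hx'⟩
    refine ⟨C.smul_mem r hx, ?_⟩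
    simp [← Finset.mul_sum, hx']

/-- The number `A_w(C)` of codewords of Hamming weight `w` in `C`. -/
noncomputable def weightCount {F ι : Type*} [Field F] [DecidableEq F] [Fintype ι]
    (C : Submodule F (ι → F)) (w : ℕ) : ℕ :=
  {c : ι → F | c ∈ C ∧ hammingNorm c = w}.ncard

/-- The set of the supports of the codewords of Hamming weight `k` in `C`. -/
def weightSupports {F ι : Type*} [Field F] [DecidableEq F] [Fintype ι]
    (C : Submodule F (ι → F)) (k : ℕ) : Set (Finset ι) :=
  {B | ∃ c ∈ C, hammingNorm c = k ∧ codewordSupport c = B}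

/-- `(P, blocks)` is a (simple) `t`-`(v, k, l)` design, where `P` is the whole point type. -/
structure IsDesign {P : Type*} [Fintype P] (t v k l : ℕ) (blocks : Set (Finset P)) : Prop where
  card_points : Fintype.card P = v
  one_le_t : 1 ≤ t
  t_le_k : t ≤ k
  k_le_v : k ≤ v
  card_block : ∀ B ∈ blocks, B.card = k
  balanced : ∀ T : Finset P, T.card = t → {B | B ∈ blocks ∧ T ⊆ B}.ncard = l

/-- The three-weight distribution required of the dual of the original code (used for odd
`m ≥ 5`, where all divisions and subtractions below are exact and the four weights are distinct). -/
def threeWeightDistribution (m w : ℕ) : ℕ :=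
  if w = 0 then 1
  else if w = 2 ^ (m - 1) - 2 ^ ((m - 1) / 2) then
    (2 ^ m - 1) * (2 ^ ((m - 1) / 2) + 1) * 2 ^ ((m - 3) / 2)
  else if w = 2 ^ (m - 1) then (2 ^ m - 1) * (2 ^ (m - 1) + 1)
  else if w = 2 ^ (m - 1) + 2 ^ ((m - 1) / 2) then
    (2 ^ m - 1) * (2 ^ ((m - 1) / 2) - 1) * 2 ^ ((m - 3) / 2)
  else 0

/-- The weight distribution of the dual of the extended code:
`1 + u z^(2^(m-1) - 2^((m-1)/2)) + v z^(2^(m-1)) + u z^(2^(m-1) + 2^((m-1)/2)) + z^(2^m)`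
with `u = 2^(2m-1) - 2^(m-1)` and `v = 2^(2m) + 2^m - 2`. -/
def extendedDualDistribution (m w : ℕ) : ℕ :=
  if w = 0 then 1
  else if w = 2 ^ (m - 1) - 2 ^ ((m - 1) / 2) then 2 ^ (2 * m - 1) - 2 ^ (m - 1)
  else if w = 2 ^ (m - 1) then 2 ^ (2 * m) + 2 ^ m - 2
  else if w = 2 ^ (m - 1) + 2 ^ ((m - 1) / 2) then 2 ^ (2 * m - 1) - 2 ^ (m - 1)
  else if w = 2 ^ m then 1
  else 0

/-- The sum of `(-1)^i * (a choose i) * (b choose j)` over `0 ≤ i ≤ a`, `0 ≤ j ≤ b`, `i + j = k`;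
the binomial coefficients vanish outside the range. -/
def signedBinomialSum (a b k : ℕ) : ℚ :=
  ∑ p ∈ Finset.HasAntidiagonal.antidiagonal k, (-1) ^ p.1 * (a.choose p.1 : ℚ) * (b.choose p.2 : ℚ)

/-- The number of codewords of weight `k` in the extended code, as an explicit expression. -/
def extendedDistribution (m k : ℕ) : ℚ :=
  ((1 + (-1) ^ k) * ((2 ^ m).choose k : ℚ)
    + (1 + (-1) ^ k) / 2 * (-1) ^ (k / 2) * ((2 ^ (m - 1)).choose (k / 2) : ℚ)
        * (2 ^ (2 * m) + 2 ^ m - 2)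
    + (2 ^ (2 * m - 1) - 2 ^ (m - 1))
        * signedBinomialSum (2 ^ (m - 1) - 2 ^ ((m - 1) / 2)) (2 ^ (m - 1) + 2 ^ ((m - 1) / 2)) k
    + (2 ^ (2 * m - 1) - 2 ^ (m - 1))
        * signedBinomialSum (2 ^ (m - 1) + 2 ^ ((m - 1) / 2)) (2 ^ (m - 1) - 2 ^ ((m - 1) / 2)) k)
  / 2 ^ (2 * m + 1)

/-! This is the Assmus–Mattson argument. Let `D` be the dual of the extended code. It consists of
the words of the dual of `C` padded by a zero, together with their complements, so its weight
distribution is that of the dual of `C` plus its reflection (`weightCount_dualCode_extendedCode`).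
The MacWilliams identity then gives the weights of the extended code. All are even, and the formula
vanishes at 2 and 4, so nonzero words have weight above 5
(`five_lt_hammingNorm_of_mem_extendedCode`). Hence `D` has strength 5: any five coordinates are
equidistributed on it.

Fix a set `T` of at most 3 points. Strength 5 determines the moments of order 0, 1, 2 of the weights
of the words of `D` through `T`. Apart from 0 and the length, whose contributions are known, only
three weights occur, so three equations determine three counts, which depend only on `T.card`
(`throughCount_eq_of_card_eq`). This is the design property of `D`. A MacWilliams identity relative
to `T` transfers it to the extended code (`throughCount_dualCode_eq_of_card_eq`), and double
counting gives `λ`. -/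

/-- The finite set of the codewords of a binary code. -/
noncomputable def codewords {ι : Type*} [Fintype ι] (E : Submodule (ZMod 2) (ι → ZMod 2)) :
    Finset (ι → ZMod 2) := by
  classical exact Finset.univ.filter (· ∈ E)

/-- The codewords whose support contains `T`. -/
noncomputable def codewordsThrough {ι : Type*} [Fintype ι]
    (E : Submodule (ZMod 2) (ι → ZMod 2)) (T : Finset ι) : Finset (ι → ZMod 2) := by
  classical exact (codewords E).filter fun e => ∀ i ∈ T, e i ≠ 0

/-- The number of codewords of weight `w` whose support contains `T`. -/
noncomputable def throughCount {ι : Type*} [Fintype ι]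
    (E : Submodule (ZMod 2) (ι → ZMod 2)) (w : ℕ) (T : Finset ι) : ℕ :=
  ((codewordsThrough E T).filter fun e => hammingNorm e = w).card

/-! ### Counting codewords by weight -/

section Basic

variable {ι : Type*} [Fintype ι] {E : Submodule (ZMod 2) (ι → ZMod 2)}

@[simp] theorem mem_codewords {e : ι → ZMod 2} : e ∈ codewords E ↔ e ∈ E := by
  simp [codewords]

@[simp] theorem mem_codewordsThrough {T : Finset ι} {e : ι → ZMod 2} :
    e ∈ codewordsThrough E T ↔ e ∈ E ∧ ∀ i ∈ T, e i ≠ 0 := by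
  simp [codewordsThrough]

theorem codewordsThrough_empty : codewordsThrough E ∅ = codewords E := by
  ext; simp

theorem weightCount_eq_card (w : ℕ) :
    weightCount E w = ((codewords E).filter fun e => hammingNorm e = w).card := by
  rw [weightCount, ← Set.ncard_coe_finset]
  congr 1
  ext; simp

theorem throughCount_empty (w : ℕ) : throughCount E w ∅ = weightCount E w := by
  rw [throughCount, codewordsThrough_empty, weightCount_eq_card]

theorem sum_codewordsThrough_weight {M : Type*} [AddCommMonoid M] (T : Finset ι) (F : ℕ → M) :
    ∑ e ∈ codewordsThrough E T, F (hammingNorm e)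
      = ∑ w ∈ Finset.range (Fintype.card ι + 1), throughCount E w T • F w := by
  rw [← Finset.sum_fiberwise_of_maps_to (t := Finset.range (Fintype.card ι + 1))
    (g := fun e : ι → ZMod 2 => hammingNorm e)]
  · refine Finset.sum_congr rfl fun w _ => ?_
    rw [throughCount, ← Finset.sum_const]
    refine Finset.sum_congr rfl fun e he => ?_
    rw [(Finset.mem_filter.1 he).2]
  · intro e _
    exact Finset.mem_range_succ_iff.2 hammingNorm_le_card_fintype

theorem sum_codewords_weight {M : Type*} [AddCommMonoid M] (F : ℕ → M) :
    ∑ e ∈ codewords E, F (hammingNorm e)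
      = ∑ w ∈ Finset.range (Fintype.card ι + 1), weightCount E w • F w := by
  rw [← codewordsThrough_empty, sum_codewordsThrough_weight]
  simp only [throughCount_empty]

end Basic

/-! ### Character sums, Poisson summation and biduality -/

section Poisson

theorem zmod_two_eq_one {x : ZMod 2} (h : x ≠ 0) : x = 1 := by
  fin_cases x
  · exact absurd rfl h
  · rfl

/-- The nontrivial sign character of `ZMod 2`. -/
def signChar (R : Type*) [Ring R] (x : ZMod 2) : R := if x = 0 then 1 else -1

theorem signChar_add (R : Type*) [Ring R] (x y : ZMod 2) :
    signChar R (x + y) = signChar R x * signChar R y := by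
  have h : (1 + 1 : ZMod 2) = 0 := rfl
  by_cases hx : x = 0
  · simp [hx, signChar]
  by_cases hy : y = 0
  · simp [hy, signChar]
  rw [zmod_two_eq_one hx, zmod_two_eq_one hy, h]
  simp [signChar]

theorem signChar_sum (R : Type*) [CommRing R] {ι : Type*} (s : Finset ι) (f : ι → ZMod 2) :
    signChar R (∑ i ∈ s, f i) = ∏ i ∈ s, signChar R (f i) := by
  classical
  induction s using Finset.induction_on with
  | empty => simp [signChar]
  | insert a s ha ih => rw [Finset.sum_insert ha, Finset.prod_insert ha, signChar_add, ih]

variable {ι : Type*} [Fintype ι] {E : Submodule (ZMod 2) (ι → ZMod 2)}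

theorem sum_signChar_of_mem (R : Type*) [CommRing R] {x : ι → ZMod 2} (hx : x ∈ dualCode E) :
    ∑ e ∈ codewords E, signChar R (∑ i, x i * e i) = (codewords E).card := by
  rw [Finset.sum_congr rfl (g := fun _ => (1 : R))]
  · simp
  · intro e he
    have : ∑ i, x i * e i = 0 := hx e (mem_codewords.1 he)
    simp [this, signChar]

/-- Translation by a codeword `e₀` not orthogonal to `x` pairs off terms of opposite sign. -/
theorem sum_signChar_of_notMem (R : Type*) [CommRing R] {x : ι → ZMod 2} (hx : x ∉ dualCode E) :
    ∑ e ∈ codewords E, signChar R (∑ i, x i * e i) = 0 := by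
  obtain ⟨e₀, he₀, h⟩ : ∃ e ∈ E, ∑ i, x i * e i ≠ 0 := by
    by_contra! hcon
    exact hx hcon
  have h1 := zmod_two_eq_one h
  refine Finset.sum_involution (fun e _ => e + e₀) ?_ ?_ ?_ ?_
  · intro e _
    simp only [Pi.add_apply, mul_add, Finset.sum_add_distrib, signChar_add, h1]
    simp [signChar]
  · intro e _ _ heq
    have : e₀ = 0 := by simpa using heq
    simp [this] at h
  · intro e he
    exact mem_codewords.2 (E.add_mem (mem_codewords.1 he) he₀)
  · intro e _
    ext i
    simp [add_assoc, CharTwo.add_self_eq_zero]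

/-- Poisson summation for binary codes, for functions that are products over the coordinates. -/
theorem poisson_codewords {R : Type*} [CommRing R] (a b : ι → R) :
    ∑ e ∈ codewords E, ∏ i, (if e i = 0 then a i + b i else a i - b i)
      = (codewords E).card * ∑ x ∈ codewords (dualCode E), ∏ i, (if x i = 0 then a i else b i) := by
  classical
  -- Each factor is a Fourier sum over `ZMod 2`; expanding the product gives a sum over all words
  -- `x`, and summing over the code leaves only `x` in the dual.
  have key : ∀ e : ι → ZMod 2, ∏ i, (if e i = 0 then a i + b i else a i - b i)
      = ∑ x : ι → ZMod 2, signChar R (∑ i, x i * e i) * ∏ i, (if x i = 0 then a i else b i) := by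
    intro e
    have h : ∀ i, (if e i = 0 then a i + b i else a i - b i)
        = ∑ y : ZMod 2, signChar R (y * e i) * (if y = 0 then a i else b i) := by
      intro i
      have h2 : ∀ f : ZMod 2 → R, ∑ y : ZMod 2, f y = f 0 + f 1 := fun f => Fin.sum_univ_two f
      rw [h2]
      by_cases he : e i = 0
      · simp [he, signChar]
      · simp [zmod_two_eq_one he, signChar, sub_eq_add_neg]
    simp_rw [h, Fintype.prod_sum, Finset.prod_mul_distrib, signChar_sum]
  simp_rw [key]
  rw [Finset.sum_comm]
  simp_rw [← Finset.sum_mul]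
  rw [Finset.mul_sum, ← Finset.sum_subset (Finset.subset_univ (codewords (dualCode E)))]
  · refine Finset.sum_congr rfl fun x hx => ?_
    rw [sum_signChar_of_mem R (mem_codewords.1 hx)]
  · intro x _ hx
    rw [sum_signChar_of_notMem R (fun h => hx (mem_codewords.2 h)), zero_mul]

/-- The dot product is a nondegenerate symmetric form in finite dimension. Results relating a code
to its dual can thus be applied with the extended code in the role of the dual. -/
theorem dualCode_dualCode (K : Submodule (ZMod 2) (ι → ZMod 2)) : dualCode (dualCode K) = K := by
  classical
  let B : LinearMap.BilinForm (ZMod 2) (ι → ZMod 2) := dotProductBilin (ZMod 2) (ZMod 2)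
  have hB : ∀ x y, B x y = ∑ i, x i * y i := fun x y => rfl
  have hrefl : B.IsRefl := by
    intro x y h
    rw [hB] at h ⊢
    simpa [mul_comm] using h
  have hnd : B.Nondegenerate := by
    refine (LinearMap.IsRefl.nondegenerate_iff_separatingLeft (B := B) hrefl).2 ?_
    intro x hx
    ext i
    have h := hx (Pi.single i 1)
    rw [hB] at h
    simpa [Pi.single_apply] using h
  have ho : ∀ W, B.orthogonal W = dualCode W := by
    intro W
    ext x
    rw [LinearMap.BilinForm.mem_orthogonal_iff]
    refine forall₂_congr fun c _ => ?_
    change B c x = 0 ↔ _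
    rw [hB]
    simp [mul_comm]
  rw [← ho, ← ho, LinearMap.BilinForm.orthogonal_orthogonal hnd hrefl]

end Poisson

/-! ### Strength, power moments and the three-weight argument -/

section Strength

variable {ι : Type*} [Fintype ι] {E : Submodule (ZMod 2) (ι → ZMod 2)}

/-- If the dual code has no nonzero word of weight at most `|T|`, the coordinates in `T` of the
codewords are equidistributed. -/
theorem two_pow_mul_card_codewordsThrough (T : Finset ι)
    (h : ∀ x ∈ dualCode E, x ≠ 0 → T.card < hammingNorm x) :
    (2 : ℚ) ^ T.card * (codewordsThrough E T).card = (codewords E).card := by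
  classical
  -- On `T` the choice gives `a + b = 0`, `a - b = 1`, and off `T` both are 1. So the left product
  -- is the indicator of passing through `T`, while the right one vanishes unless `x` is supported
  -- in `T`.
  have hP := poisson_codewords (E := E) (fun i => if i ∈ T then (1 / 2 : ℚ) else 1)
    (fun i => if i ∈ T then (-1 / 2 : ℚ) else 0)
  have hL : ∑ e ∈ codewords E, (∏ i, (if e i = 0
        then (if i ∈ T then (1 / 2 : ℚ) else 1) + (if i ∈ T then (-1 / 2 : ℚ) else 0)
        else (if i ∈ T then (1 / 2 : ℚ) else 1) - (if i ∈ T then (-1 / 2 : ℚ) else 0)))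
      = (codewordsThrough E T).card := by
    rw [codewordsThrough, Finset.card_filter, Nat.cast_sum]
    refine Finset.sum_congr (by congr) fun e _ => ?_
    split_ifs with he
    · rw [Nat.cast_one]
      refine Finset.prod_eq_one fun i _ => ?_
      by_cases hi : i ∈ T
      · simp only [he i hi, hi, if_true, if_false]; norm_num
      · simp [hi]
    · push Not at he
      obtain ⟨i, hi, hei⟩ := he
      rw [Nat.cast_zero]
      refine Finset.prod_eq_zero (Finset.mem_univ i) ?_
      simp only [hi, hei, if_true]; norm_num
  have hR : ∑ x ∈ codewords (dualCode E), (∏ i, (if x i = 0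
        then (if i ∈ T then (1 / 2 : ℚ) else 1) else (if i ∈ T then (-1 / 2 : ℚ) else 0)))
      = (1 / 2) ^ T.card := by
    rw [Finset.sum_eq_single 0]
    · simp
    · intro x hx hx0
      have hlt := h x (mem_codewords.1 hx) hx0
      obtain ⟨i, hi, hiT⟩ := Finset.exists_mem_notMem_of_card_lt_card hlt
      refine Finset.prod_eq_zero (Finset.mem_univ i) ?_
      have : x i ≠ 0 := (Finset.mem_filter.1 hi).2
      simp [this, hiT]
    · intro h0
      exact absurd (mem_codewords.2 (Submodule.zero_mem _)) h0
  rw [hL, hR] at hP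
  rw [hP, mul_left_comm, ← mul_pow]
  norm_num

theorem hammingNorm_cast_eq_sum (e : ι → ZMod 2) :
    (hammingNorm e : ℚ) = ∑ i, if e i ≠ 0 then 1 else 0 := by
  rw [hammingNorm, Finset.card_filter, Nat.cast_sum]
  simp

/-- The value at `t` of the `j`-th power moment of the weights of the codewords through `t` given
points, for a code of length `n` with `s` words that has strength at least `t + j`. -/
def powerMoment (s n : ℚ) : ℕ → ℕ → ℚ
  | 0, t => s / 2 ^ t
  | j + 1, t => t * powerMoment s n j t + (n - t) * powerMoment s n j (t + 1)

/-- One factor of the weight is written as a sum of indicators `e i ≠ 0` and the sums are exchanged: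
a point of `T` leaves `T` unchanged, any other enlarges it by one. This is the recursion of
`powerMoment`, and `T.card + j` never exceeds the strength. -/
theorem sum_hammingNorm_pow {d : ℕ} (h : ∀ x ∈ dualCode E, x ≠ 0 → d < hammingNorm x) (j : ℕ) :
    ∀ T : Finset ι, T.card + j ≤ d →
      ∑ e ∈ codewordsThrough E T, (hammingNorm e : ℚ) ^ j
        = powerMoment (codewords E).card (Fintype.card ι) j T.card := by
  classical
  induction j with
  | zero =>
    intro T hT
    have := two_pow_mul_card_codewordsThrough T fun x hx hx0 => lt_of_le_of_lt hT (h x hx hx0)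
    simp only [powerMoment, pow_zero, Finset.sum_const, nsmul_eq_mul, mul_one]
    rw [← this]
    field_simp
  | succ j ih =>
    intro T hT
    have h1 : ∀ i, ∑ e ∈ codewordsThrough E T, (if e i ≠ 0 then (hammingNorm e : ℚ) ^ j else 0)
        = if i ∈ T then powerMoment (codewords E).card (Fintype.card ι) j T.card
          else powerMoment (codewords E).card (Fintype.card ι) j (T.card + 1) := by
      intro i
      rw [← Finset.sum_filter]
      have h2 : (codewordsThrough E T).filter (fun e => e i ≠ 0)
          = codewordsThrough E (insert i T) := by
        ext e
        simp only [Finset.mem_filter, mem_codewordsThrough, Finset.forall_mem_insert]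
        tauto
      rw [h2]
      split_ifs with hi
      · rw [Finset.insert_eq_of_mem hi, ih T (by omega)]
      · rw [ih _ (by rw [Finset.card_insert_of_notMem hi]; omega), Finset.card_insert_of_notMem hi]
    have h3 : ∀ e : ι → ZMod 2, (hammingNorm e : ℚ) ^ (j + 1)
        = ∑ i, if e i ≠ 0 then (hammingNorm e : ℚ) ^ j else 0 := by
      intro e
      rw [pow_succ]
      nth_rewrite 2 [hammingNorm_cast_eq_sum]
      rw [Finset.mul_sum]
      simp
    simp_rw [h3]
    rw [Finset.sum_comm]
    simp_rw [h1]
    rw [Finset.sum_ite, Finset.sum_const, Finset.sum_const]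
    have h4 : (Finset.univ.filter fun i => i ∈ T) = T := by ext; simp
    have h5 : (Finset.univ.filter fun i => i ∉ T) = Tᶜ := by ext; simp
    rw [h4, h5, Finset.card_compl, nsmul_eq_mul, nsmul_eq_mul, powerMoment,
      Nat.cast_sub (Finset.card_le_univ T)]

theorem throughCount_zero (T : Finset ι) : throughCount E 0 T = if T.card = 0 then 1 else 0 := by
  classical
  rw [throughCount]
  split_ifs with hT
  · rw [Finset.card_eq_one]
    refine ⟨0, ?_⟩
    ext e
    rw [Finset.card_eq_zero] at hT
    subst hT
    simp only [Finset.mem_filter, mem_codewordsThrough, hammingNorm_eq_zero, Finset.mem_singleton]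
    constructor
    · exact fun h => h.2
    · rintro rfl
      simp
  · obtain ⟨i, hi⟩ := Finset.card_pos.1 (Nat.pos_of_ne_zero hT)
    rw [Finset.card_eq_zero, Finset.filter_eq_empty_iff]
    intro e he h0
    exact (mem_codewordsThrough.1 he).2 i hi (by rw [hammingNorm_eq_zero.1 h0]; rfl)

theorem throughCount_card (T : Finset ι) :
    throughCount E (Fintype.card ι) T = weightCount E (Fintype.card ι) := by
  classical
  rw [throughCount, weightCount_eq_card]
  congr 1
  ext e
  simp only [Finset.mem_filter, mem_codewordsThrough, mem_codewords]
  constructor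
  · exact fun h => ⟨h.1.1, h.2⟩
  · rintro ⟨h1, h2⟩
    refine ⟨⟨h1, fun i _ => ?_⟩, h2⟩
    rw [hammingNorm, Finset.card_eq_iff_eq_univ] at h2
    have h3 := Finset.mem_univ i
    rw [← h2] at h3
    exact (Finset.mem_filter.1 h3).2

theorem throughCount_le_weightCount (w : ℕ) (T : Finset ι) :
    throughCount E w T ≤ weightCount E w := by
  rw [throughCount, weightCount_eq_card]
  refine Finset.card_le_card fun e => ?_
  simp only [Finset.mem_filter, mem_codewordsThrough, mem_codewords]
  exact fun h => ⟨h.1.1, h.2⟩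

/-- A code of strength `5` with at most three weights other than `0` and the length: the
number of codewords of given weight through at most three points depends only on the number of
points. -/
theorem throughCount_eq_of_card_eq (h : ∀ x ∈ dualCode E, x ≠ 0 → 5 < hammingNorm x)
    {w₁ w₂ w₃ : ℕ} (h₁₂ : w₁ ≠ w₂) (h₁₃ : w₁ ≠ w₃) (h₂₃ : w₂ ≠ w₃)
    (hw : ∀ w, w ≠ 0 → w ≠ w₁ → w ≠ w₂ → w ≠ w₃ → w ≠ Fintype.card ι → weightCount E w = 0)
    {T T' : Finset ι} (hT : T.card = T'.card) (hT3 : T.card ≤ 3) (w : ℕ) :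
    throughCount E w T = throughCount E w T' := by
  by_cases hd : w = 0 ∨ w = Fintype.card ι ∨ weightCount E w = 0
  · rcases hd with rfl | rfl | h0
    · rw [throughCount_zero, throughCount_zero, hT]
    · rw [throughCount_card, throughCount_card]
    · have h1 := throughCount_le_weightCount (E := E) w T
      have h2 := throughCount_le_weightCount (E := E) w T'
      omega
  push Not at hd
  obtain ⟨p, q, hpw, hqw, hpq⟩ : ∃ p q : ℕ, p ≠ w ∧ q ≠ w ∧
      ∀ x, x ≠ 0 → x ≠ Fintype.card ι → x ≠ w → x ≠ p → x ≠ q → weightCount E x = 0 := by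
    have hcase : w = w₁ ∨ w = w₂ ∨ w = w₃ := by
      by_contra! hcon
      exact hd.2.2 (hw w hd.1 hcon.1 hcon.2.1 hcon.2.2 hd.2.1)
    rcases hcase with rfl | rfl | rfl
    · exact ⟨w₂, w₃, h₁₂.symm, h₁₃.symm, fun x a b c d e => hw x a c d e b⟩
    · exact ⟨w₁, w₃, h₁₂, h₂₃.symm, fun x a b c d e => hw x a d c e b⟩
    · exact ⟨w₁, w₂, h₁₃, h₂₃, fun x a b c d e => hw x a d e c b⟩
  -- The quadratic with roots at the other two weights isolates `w`; its sum uses only moments of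
  -- order at most 2, available since `3 + 2 ≤ 5`.
  have hsum : ∀ U : Finset ι, U.card ≤ 3 →
      ∑ x ∈ Finset.range (Fintype.card ι + 1),
          (throughCount E x U : ℚ) * (((x : ℚ) - p) * (x - q))
        = powerMoment (codewords E).card (Fintype.card ι) 2 U.card
          - (p + q) * powerMoment (codewords E).card (Fintype.card ι) 1 U.card
          + p * q * powerMoment (codewords E).card (Fintype.card ι) 0 U.card := by
    intro U hU
    rw [← sum_hammingNorm_pow h 2 U (by omega), ← sum_hammingNorm_pow h 1 U (by omega),
      ← sum_hammingNorm_pow h 0 U (by omega), Finset.mul_sum, Finset.mul_sum,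
      ← Finset.sum_sub_distrib, ← Finset.sum_add_distrib]
    have := sum_codewordsThrough_weight (E := E) U (fun x => ((x : ℚ) - p) * (x - q))
    simp only [nsmul_eq_mul] at this
    rw [← this]
    refine Finset.sum_congr rfl fun e _ => ?_
    ring
  have hdiff : ∑ x ∈ Finset.range (Fintype.card ι + 1),
      ((throughCount E x T : ℚ) - throughCount E x T') * (((x : ℚ) - p) * (x - q)) = 0 := by
    simp_rw [sub_mul _ _ (((_ : ℚ) - (p : ℚ)) * _)]
    rw [Finset.sum_sub_distrib, hsum T hT3, hsum T' (hT ▸ hT3), hT, sub_self]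
  rw [Finset.sum_eq_single w] at hdiff
  · have hp : (w : ℚ) - p ≠ 0 := sub_ne_zero.2 (by exact_mod_cast hpw.symm)
    have hq : (w : ℚ) - q ≠ 0 := sub_ne_zero.2 (by exact_mod_cast hqw.symm)
    have := (mul_eq_zero.1 hdiff).resolve_right (mul_ne_zero hp hq)
    exact_mod_cast sub_eq_zero.1 this
  · intro x _ hxw
    by_cases hxp : x = p
    · simp [hxp]
    by_cases hxq : x = q
    · simp [hxq]
    have heq : throughCount E x T = throughCount E x T' := by
      by_cases hx0 : x = 0
      · subst hx0
        rw [throughCount_zero, throughCount_zero, hT]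
      by_cases hxn : x = Fintype.card ι
      · subst hxn
        rw [throughCount_card, throughCount_card]
      have h0 := hpq x hx0 hxn hxw hxp hxq
      have h1 := throughCount_le_weightCount (E := E) x T
      have h2 := throughCount_le_weightCount (E := E) x T'
      omega
    simp [heq]
  · intro hwr
    have : weightCount E w = 0 := by
      rw [weightCount_eq_card, Finset.card_eq_zero, Finset.filter_eq_empty_iff]
      rintro e _ rfl
      exact hwr (Finset.mem_range_succ_iff.2 hammingNorm_le_card_fintype)
    exact absurd this hd.2.2

end Strength

/-! ### Transfer to the dual code, and designs from constant counts -/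

section Dual

variable {ι : Type*} [Fintype ι] {E : Submodule (ZMod 2) (ι → ZMod 2)}

open Polynomial in
/-- The weight enumerator of the codewords through `T`. -/
noncomputable def throughEnumerator (E : Submodule (ZMod 2) (ι → ZMod 2)) (T : Finset ι) : ℚ[X] :=
  ∑ e ∈ codewordsThrough E T, X ^ hammingNorm e

theorem coeff_throughEnumerator (T : Finset ι) (k : ℕ) :
    (throughEnumerator E T).coeff k = throughCount E k T := by
  rw [throughEnumerator, Polynomial.finsetSum_coeff, throughCount, Finset.card_filter,
    Nat.cast_sum]
  refine Finset.sum_congr rfl fun e _ => ?_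
  rw [Polynomial.coeff_X_pow]
  simp [eq_comm]

theorem prod_ite_eq_pow_hammingNorm {R : Type*} [CommRing R] (e : ι → ZMod 2) (p q : R) :
    ∏ i, (if e i = 0 then p else q) = q ^ hammingNorm e * p ^ (Fintype.card ι - hammingNorm e) := by
  classical
  rw [Finset.prod_ite, Finset.prod_const, Finset.prod_const, mul_comm]
  have h : (Finset.univ.filter fun i => e i = 0).card = Fintype.card ι - hammingNorm e := by
    have h1 := Finset.card_filter_add_card_filter_not (s := Finset.univ) (fun i => e i = 0)
    rw [Finset.card_univ] at h1
    exact Nat.eq_sub_of_add_eq h1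
  rw [h]
  rfl

/-- MacWilliams identity for binary codes. -/
theorem card_mul_throughEnumerator_dualCode :
    ((codewords E).card : Polynomial ℚ) * throughEnumerator (dualCode E) ∅
      = ∑ e ∈ codewords E, (1 - Polynomial.X) ^ hammingNorm e
          * (1 + Polynomial.X) ^ (Fintype.card ι - hammingNorm e) := by
  have h := poisson_codewords (E := E) (fun _ => (1 : Polynomial ℚ)) (fun _ => Polynomial.X)
  simp only [prod_ite_eq_pow_hammingNorm, one_pow, mul_one] at h
  rw [h, throughEnumerator, codewordsThrough_empty]

/-- Poisson summation with `a = 0` on `T` restricts the dual side to words through `T`. On the other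
side, each coordinate in `T` changes the usual factor `1 ± z` by the ratio `z / (1 + z)` or `-z / (1
- z)`. Writing this ratio as a constant plus a jump where `e i ≠ 0` and expanding gives the sum over
`J ⊆ T`. The bound on `z` keeps both denominators nonzero. -/
theorem card_mul_eval_throughEnumerator_dualCode (T : Finset ι) {z : ℚ} (hz : 1 < z) :
    (codewords E).card * (throughEnumerator (dualCode E) T).eval z
      = ∑ J ∈ T.powerset, (-z / (1 - z) - z / (1 + z)) ^ J.card * (z / (1 + z)) ^ (T.card - J.card)
          * ∑ w ∈ Finset.range (Fintype.card ι + 1), throughCount E w J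
              * ((1 - z) ^ w * (1 + z) ^ (Fintype.card ι - w)) := by
  classical
  have h := poisson_codewords (E := E) (fun i => if i ∈ T then (0 : ℚ) else 1) (fun _ => z)
  have hR : ∑ x ∈ codewords (dualCode E),
      (∏ i, (if x i = 0 then (if i ∈ T then (0 : ℚ) else 1) else z))
      = (throughEnumerator (dualCode E) T).eval z := by
    rw [throughEnumerator, Polynomial.eval_finsetSum, codewordsThrough, Finset.sum_filter]
    refine Finset.sum_congr rfl fun x _ => ?_
    split_ifs with hx
    · have h2 := prod_ite_eq_pow_hammingNorm x (1 : ℚ) z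
      simp only [one_pow, mul_one] at h2
      rw [Polynomial.eval_pow, Polynomial.eval_X, ← h2]
      refine Finset.prod_congr rfl fun i _ => ?_
      by_cases hi : i ∈ T
      · simp [hx i hi]
      · simp [hi]
    · push Not at hx
      obtain ⟨i, hi, hxi⟩ := hx
      exact Finset.prod_eq_zero (Finset.mem_univ i) (by simp [hi, hxi])
  rw [← hR, ← h]
  have hz1 : 1 - z ≠ 0 := by linarith
  have hz2 : 1 + z ≠ 0 := by linarith
  have hprod : ∀ e : ι → ZMod 2, ∏ i, (if e i = 0 then (if i ∈ T then (0 : ℚ) else 1) + z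
        else (if i ∈ T then (0 : ℚ) else 1) - z)
      = ∑ J ∈ T.powerset, if (∀ i ∈ J, e i ≠ 0) then
          (-z / (1 - z) - z / (1 + z)) ^ J.card * (z / (1 + z)) ^ (T.card - J.card)
          * ((1 - z) ^ hammingNorm e * (1 + z) ^ (Fintype.card ι - hammingNorm e)) else 0 := by
    intro e
    have h3 : ∀ i, (if e i = 0 then (if i ∈ T then (0 : ℚ) else 1) + z
        else (if i ∈ T then (0 : ℚ) else 1) - z)
        = (if e i = 0 then 1 + z else 1 - z) * (if i ∈ T then
          ((if e i ≠ 0 then -z / (1 - z) - z / (1 + z) else 0) + z / (1 + z)) else 1) := by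
      intro i
      by_cases hi : i ∈ T <;> by_cases he : e i = 0 <;> simp only [hi, he, ne_eq, if_true, if_false,
        not_true, not_false_iff] <;> field_simp <;> ring
    simp_rw [h3]
    rw [Finset.prod_mul_distrib, prod_ite_eq_pow_hammingNorm, Finset.prod_ite_mem,
      Finset.univ_inter, Finset.prod_add, Finset.mul_sum]
    refine Finset.sum_congr rfl fun J hJ => ?_
    rw [Finset.prod_const, Finset.card_sdiff_of_subset (Finset.mem_powerset.1 hJ)]
    split_ifs with hc
    · rw [Finset.prod_congr rfl fun i hi => if_pos (hc i hi), Finset.prod_const]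
      ring
    · push Not at hc
      obtain ⟨i, hi, hei⟩ := hc
      rw [Finset.prod_eq_zero hi (by simp [hei])]
      ring
  simp_rw [hprod]
  rw [Finset.sum_comm]
  refine Finset.sum_congr rfl fun J _ => ?_
  rw [← Finset.sum_filter, ← Finset.mul_sum]
  congr 1
  have := sum_codewordsThrough_weight (E := E) J
    (fun w => (1 - z) ^ w * (1 + z) ^ (Fintype.card ι - w))
  simp only [nsmul_eq_mul] at this
  rw [← this, codewordsThrough]

theorem card_codewords_ne_zero : (codewords E).card ≠ 0 :=
  Finset.card_ne_zero_of_mem (mem_codewords.2 E.zero_mem)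

/-- If the numbers of codewords of given weight through the points of a set depend only on the
size of the set, then the same holds for the dual code. -/
theorem throughCount_dualCode_eq_of_card_eq {t : ℕ}
    (h : ∀ (w : ℕ) (J J' : Finset ι), J.card = J'.card → J.card ≤ t →
      throughCount E w J = throughCount E w J')
    {T T' : Finset ι} (hT : T.card = t) (hT' : T'.card = t) (k : ℕ) :
    throughCount (dualCode E) k T = throughCount (dualCode E) k T' := by
  classical
  obtain ⟨c, hc⟩ : ∃ c : ℕ → ℕ → ℕ, ∀ w, ∀ J : Finset ι, J.card ≤ t →
      throughCount E w J = c w J.card := by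
    -- The default 0 is never used: it concerns only sizes that no subset has.
    refine ⟨fun w j => if hj : ∃ J : Finset ι, J.card = j then throughCount E w hj.choose else 0,
      fun w J hJ => ?_⟩
    have hj : ∃ J' : Finset ι, J'.card = J.card := ⟨J, rfl⟩
    simp only [dif_pos hj]
    exact h w _ _ hj.choose_spec.symm hJ
  have key : ∀ U : Finset ι, U.card = t → ∀ z : ℚ, 1 < z →
      (codewords E).card * (throughEnumerator (dualCode E) U).eval z
      = ∑ j ∈ Finset.range (t + 1), t.choose j •
          ((-z / (1 - z) - z / (1 + z)) ^ j * (z / (1 + z)) ^ (t - j)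
          * ∑ w ∈ Finset.range (Fintype.card ι + 1), (c w j : ℚ)
              * ((1 - z) ^ w * (1 + z) ^ (Fintype.card ι - w))) := by
    intro U hU z hz
    rw [card_mul_eval_throughEnumerator_dualCode U hz, ← hU]
    rw [← Finset.sum_powerset_apply_card (fun j =>
          ((-z / (1 - z) - z / (1 + z)) ^ j * (z / (1 + z)) ^ (U.card - j)
          * ∑ w ∈ Finset.range (Fintype.card ι + 1), (c w j : ℚ)
              * ((1 - z) ^ w * (1 + z) ^ (Fintype.card ι - w))))]
    refine Finset.sum_congr rfl fun J hJ => ?_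
    congr 1
    refine Finset.sum_congr rfl fun w _ => ?_
    rw [hc w J (hU ▸ Finset.card_le_card (Finset.mem_powerset.1 hJ))]
  have hG : throughEnumerator (dualCode E) T = throughEnumerator (dualCode E) T' := by
    -- Agreement at the infinitely many rationals above 1 suffices for equality of polynomials.
    refine Polynomial.eq_of_infinite_eval_eq _ _ ((Set.Ioi_infinite (1 : ℚ)).mono fun z hz => ?_)
    have h0 : ((codewords E).card : ℚ) ≠ 0 := by exact_mod_cast card_codewords_ne_zero
    exact mul_left_cancel₀ h0 ((key T hT z hz).trans (key T' hT' z hz).symm)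
  have := coeff_throughEnumerator (E := dualCode E) T k
  rw [hG, coeff_throughEnumerator] at this
  exact_mod_cast this.symm

/-- Double counting of the pairs of a `t`-set and a word of weight `k` through it. -/
theorem choose_mul_throughCount {t k l : ℕ}
    (h : ∀ T : Finset ι, T.card = t → throughCount E k T = l) :
    (Fintype.card ι).choose t * l = weightCount E k * k.choose t := by
  classical
  have h1 := Finset.sum_card_bipartiteAbove_eq_sum_card_bipartiteBelow
    (s := Finset.univ.powersetCard t) (t := (codewords E).filter fun e => hammingNorm e = k)
    (fun (T : Finset ι) (e : ι → ZMod 2) => ∀ i ∈ T, e i ≠ 0)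
  rw [Finset.sum_congr rfl (g := fun _ => l), Finset.sum_congr rfl (s₁ := Finset.filter _ _)
    (g := fun _ => k.choose t)] at h1
  · simpa [← weightCount_eq_card] using h1
  · intro e he
    obtain ⟨_, hek⟩ := Finset.mem_filter.1 he
    rw [← hek, hammingNorm, ← Finset.card_powersetCard]
    congr 1
    ext T
    simp only [Finset.mem_bipartiteBelow, Finset.mem_powersetCard, true_and,
      Finset.subset_iff, Finset.mem_filter, Finset.mem_univ]
    tauto
  · intro T hT
    rw [← h T (Finset.mem_powersetCard.1 hT).2, throughCount]
    congr 1
    ext e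
    simp only [Finset.mem_bipartiteAbove, Finset.mem_filter, mem_codewords, mem_codewordsThrough]
    tauto

/-- Over `ZMod 2` distinct words give distinct blocks, so counting blocks is counting codewords. -/
theorem codewordSupport_injective :
    Function.Injective (codewordSupport : (ι → ZMod 2) → Finset ι) := by
  intro x y hxy
  ext i
  have h : x i ≠ 0 ↔ y i ≠ 0 := by
    have := Finset.ext_iff.1 hxy i
    simpa [codewordSupport] using this
  by_cases hx : x i = 0
  · have hy : y i = 0 := by
      by_contra hy
      exact h.2 hy hx
    rw [hx, hy]
  · rw [zmod_two_eq_one hx, zmod_two_eq_one (h.1 hx)]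

theorem ncard_weightSupports_through (k : ℕ) (T : Finset ι) :
    {B | B ∈ weightSupports E k ∧ T ⊆ B}.ncard = throughCount E k T := by
  rw [throughCount, ← Set.ncard_coe_finset,
    ← Set.ncard_image_of_injective _ codewordSupport_injective]
  congr 1
  ext B
  simp only [weightSupports, Set.mem_ofPred_eq, Set.mem_image, Finset.mem_coe, Finset.mem_filter,
    mem_codewordsThrough]
  constructor
  · rintro ⟨⟨c, hc, hk, rfl⟩, hT⟩
    exact ⟨c, ⟨⟨hc, fun i hi => (Finset.mem_filter.1 (hT hi)).2⟩, hk⟩, rfl⟩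
  · rintro ⟨c, ⟨⟨hc, hT⟩, hk⟩, rfl⟩
    exact ⟨⟨c, hc, hk, rfl⟩, fun i hi => Finset.mem_filter.2 ⟨Finset.mem_univ i, hT i hi⟩⟩

theorem exists_isDesign_weightSupports {n t k : ℕ} (hn : Fintype.card ι = n) (ht : 1 ≤ t)
    (htk : t ≤ k) (hk : weightCount E k ≠ 0)
    (h : ∀ T T' : Finset ι, T.card = t → T'.card = t → throughCount E k T = throughCount E k T') :
    ∃ l : ℕ, (l : ℚ) = (weightCount E k : ℚ) * (k.choose t : ℚ) / (n.choose t : ℚ) ∧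
      IsDesign t n k l (weightSupports E k) := by
  subst hn
  have hkn : k ≤ Fintype.card ι := by
    rw [weightCount_eq_card, ← Nat.pos_iff_ne_zero, Finset.card_pos] at hk
    obtain ⟨e, he⟩ := hk
    rw [← (Finset.mem_filter.1 he).2]
    exact hammingNorm_le_card_fintype
  obtain ⟨T₀, _, hT₀⟩ := Finset.exists_subset_card_eq (s := (Finset.univ : Finset ι)) (n := t)
    (by rw [Finset.card_univ]; omega)
  have hl : ∀ T : Finset ι, T.card = t → throughCount E k T = throughCount E k T₀ :=
    fun T hT => h T T₀ hT hT₀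
  refine ⟨throughCount E k T₀, ?_, rfl, ht, htk, hkn, ?_, ?_⟩
  · have h1 := choose_mul_throughCount hl
    have h2 : ((Fintype.card ι).choose t : ℚ) ≠ 0 := by
      exact_mod_cast (Nat.choose_pos (htk.trans hkn)).ne'
    rw [eq_div_iff h2, mul_comm]
    exact_mod_cast h1
  · rintro B ⟨c, _, hck, rfl⟩
    exact hck
  · intro T hT
    rw [ncard_weightSupports_through, hl T hT]

end Dual

/-! ### The extended code and its dual -/

section Extended

variable {n : ℕ} {C : Submodule (ZMod 2) (Fin n → ZMod 2)}

theorem mem_dualCode_extendedCode_iff {x : Fin (n + 1) → ZMod 2} (hx : x (Fin.last n) = 0) :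
    x ∈ dualCode (extendedCode C) ↔ Fin.init x ∈ dualCode C := by
  constructor
  · intro h c hc
    have h1 := h (Fin.snoc c (∑ i, c i)) (by
      refine ⟨?_, ?_⟩
      · simpa using hc
      · rw [Fin.sum_univ_castSucc]
        simp [CharTwo.add_self_eq_zero])
    rw [Fin.sum_univ_castSucc] at h1
    simpa [hx, Fin.init] using h1
  · rintro h e ⟨he, _⟩
    rw [Fin.sum_univ_castSucc, hx, zero_mul, add_zero]
    exact h _ he

theorem one_mem_dualCode_extendedCode : (1 : Fin (n + 1) → ZMod 2) ∈ dualCode (extendedCode C) := by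
  rintro e ⟨_, he⟩
  simpa using he

theorem hammingNorm_init {x : Fin (n + 1) → ZMod 2} (hx : x (Fin.last n) = 0) :
    hammingNorm (Fin.init x : Fin n → ZMod 2) = hammingNorm x := by
  simp only [hammingNorm, Finset.card_filter]
  rw [Fin.sum_univ_castSucc, if_neg (not_not.2 hx), add_zero]
  rfl

theorem hammingNorm_add_one {ι : Type*} [Fintype ι] (x : ι → ZMod 2) :
    hammingNorm (x + 1) + hammingNorm x = Fintype.card ι := by
  have h1 := Finset.card_filter_add_card_filter_not (s := Finset.univ) (fun i => x i = 0)
  rw [Finset.card_univ] at h1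
  rw [← h1, hammingNorm, hammingNorm]
  congr 2
  ext i
  have h2 : (1 + 1 : ZMod 2) = 0 := rfl
  by_cases hx : x i = 0
  · simp [hx]
  · simp [zmod_two_eq_one hx, h2]

theorem add_one_add_one {ι : Type*} (x : ι → ZMod 2) : x + 1 + 1 = x := by
  ext i
  simp [add_assoc, CharTwo.add_self_eq_zero]

/-- Dual words ending in 0 are padded words of the dual of `C`. Adding the all-one word, which lies
in the dual because extended words have coordinate sum zero, exchanges last coordinates 0 and 1 and
sends weight `k` to `n + 1 - k`. -/
theorem weightCount_dualCode_extendedCode (k : ℕ) :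
    weightCount (dualCode (extendedCode C)) k = weightCount (dualCode C) k
      + if k ≤ n + 1 then weightCount (dualCode C) (n + 1 - k) else 0 := by
  classical
  rw [weightCount_eq_card,
    ← Finset.card_filter_add_card_filter_not (fun x : Fin (n + 1) → ZMod 2 => x (Fin.last n) = 0)]
  congr 1
  · rw [weightCount_eq_card]
    refine Finset.card_nbij' (fun x => Fin.init x) (fun d => Fin.snoc d 0) ?_ ?_ ?_ ?_
    · intro x hx
      simp only [Finset.coe_filter, Finset.mem_filter, mem_codewords, Set.mem_ofPred_eq] at hx ⊢
      exact ⟨(mem_dualCode_extendedCode_iff hx.2).1 hx.1.1, by rw [hammingNorm_init hx.2, hx.1.2]⟩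
    · intro d hd
      simp only [Finset.coe_filter, Finset.mem_filter, mem_codewords, Set.mem_ofPred_eq] at hd ⊢
      have h0 : (Fin.snoc d 0 : Fin (n + 1) → ZMod 2) (Fin.last n) = 0 := by simp
      refine ⟨⟨(mem_dualCode_extendedCode_iff h0).2 (by simpa using hd.1), ?_⟩, h0⟩
      rw [← hammingNorm_init h0]
      simpa using hd.2
    · intro x hx
      have h0 := (Finset.mem_filter.1 hx).2
      change Fin.snoc (Fin.init x) 0 = x
      rw [← h0, Fin.snoc_init_self]
    · intro d _
      simp
  · have hcount : (if k ≤ n + 1 then weightCount (dualCode C) (n + 1 - k) else 0)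
        = ((codewords (dualCode C)).filter fun d => hammingNorm d + k = n + 1).card := by
      split_ifs with hk
      · rw [weightCount_eq_card]
        congr 1
        ext d
        simp only [Finset.mem_filter]
        refine and_congr_right fun _ => ?_
        omega
      · symm
        rw [Finset.card_eq_zero, Finset.filter_eq_empty_iff]
        intro d _
        omega
    rw [hcount]
    refine Finset.card_nbij' (fun x => Fin.init (x + 1)) (fun d => Fin.snoc d 0 + 1) ?_ ?_ ?_ ?_
    · intro x hx
      simp only [Finset.coe_filter, Finset.mem_filter, mem_codewords, Set.mem_ofPred_eq] at hx ⊢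
      have h0 : (x + 1) (Fin.last n) = 0 := by
        rw [Pi.add_apply, zmod_two_eq_one hx.2]
        rfl
      refine ⟨(mem_dualCode_extendedCode_iff h0).1
        (Submodule.add_mem _ hx.1.1 one_mem_dualCode_extendedCode), ?_⟩
      rw [hammingNorm_init h0, ← hx.1.2, hammingNorm_add_one, Fintype.card_fin]
    · intro d hd
      simp only [Finset.coe_filter, Finset.mem_filter, mem_codewords, Set.mem_ofPred_eq] at hd ⊢
      have h0 : (Fin.snoc d 0 : Fin (n + 1) → ZMod 2) (Fin.last n) = 0 := by simp
      refine ⟨⟨Submodule.add_mem _ ((mem_dualCode_extendedCode_iff h0).2 (by simpa using hd.1))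
        one_mem_dualCode_extendedCode, ?_⟩, by simp⟩
      have h1 := hammingNorm_add_one (Fin.snoc d 0 : Fin (n + 1) → ZMod 2)
      rw [← hammingNorm_init h0, Fin.init_snoc, Fintype.card_fin] at h1
      omega
    · intro x hx
      have h0 : (x + 1) (Fin.last n) = 0 := by
        rw [Pi.add_apply, zmod_two_eq_one (Finset.mem_filter.1 hx).2]
        rfl
      change Fin.snoc (Fin.init (x + 1)) 0 + 1 = x
      rw [← h0, Fin.snoc_init_self, add_one_add_one]
    · intro d _
      simp [add_one_add_one]

theorem even_hammingNorm_of_mem_extendedCode {x : Fin (n + 1) → ZMod 2}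
    (hx : x ∈ extendedCode C) : Even (hammingNorm x) := by
  have h1 : (hammingNorm x : ZMod 2) = ∑ i, x i := by
    rw [hammingNorm, Finset.card_filter, Nat.cast_sum]
    refine Finset.sum_congr rfl fun i _ => ?_
    by_cases h : x i = 0
    · simp [h]
    · simp [zmod_two_eq_one h]
  rw [hx.2] at h1
  exact (ZMod.natCast_eq_zero_iff_even).1 h1

end Extended

/-! ### Coefficients of `(1 - X)^a (1 + X)^b` -/

section Binomial

open Polynomial

theorem coeff_one_sub_X_pow (a k : ℕ) : ((1 - X : ℚ[X]) ^ a).coeff k = (-1) ^ k * a.choose k := by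
  have h : (1 - X : ℚ[X]) ^ a = ((1 + X) ^ a).comp (C (-1) * X) := by
    simp [sub_eq_add_neg]
  rw [h, comp_C_mul_X_coeff, coeff_one_add_X_pow, mul_comm]

theorem coeff_one_sub_X_pow_mul_one_add_X_pow (a b k : ℕ) :
    ((1 - X : ℚ[X]) ^ a * (1 + X) ^ b).coeff k = signedBinomialSum a b k := by
  rw [coeff_mul, signedBinomialSum]
  simp_rw [coeff_one_sub_X_pow, coeff_one_add_X_pow]

theorem signedBinomialSum_zero_left (b k : ℕ) : signedBinomialSum 0 b k = b.choose k := by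
  rw [← coeff_one_sub_X_pow_mul_one_add_X_pow, pow_zero, one_mul, coeff_one_add_X_pow]

theorem signedBinomialSum_zero_right (a k : ℕ) :
    signedBinomialSum a 0 k = (-1) ^ k * a.choose k := by
  rw [← coeff_one_sub_X_pow_mul_one_add_X_pow, pow_zero, mul_one, coeff_one_sub_X_pow]

theorem signedBinomialSum_self (h k : ℕ) :
    signedBinomialSum h h k = (1 + (-1) ^ k) / 2 * (-1) ^ (k / 2) * h.choose (k / 2) := by
  -- The product is `(1 - X ^ 2) ^ h`, so only even coefficients survive.
  have h1 : (1 - X : ℚ[X]) ^ h * (1 + X) ^ h = expand ℚ 2 ((1 - X) ^ h) := by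
    rw [← mul_pow]
    simp only [map_pow, map_sub, map_one, expand_X]
    ring
  rw [← coeff_one_sub_X_pow_mul_one_add_X_pow, h1, coeff_expand two_pos, coeff_one_sub_X_pow]
  rcases Nat.even_or_odd k with hk | hk
  · rw [if_pos hk.two_dvd, hk.neg_one_pow]
    ring
  · rw [if_neg (by rwa [← even_iff_two_dvd, Nat.not_even_iff_odd]), hk.neg_one_pow]
    ring

theorem cast_choose_succ_mul (n k : ℕ) :
    (n.choose (k + 1) : ℚ) * (k + 1) = n.choose k * (n - k) := by
  rcases le_or_gt k n with h | h
  · have := Nat.choose_succ_right_eq n k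
    rw [← Nat.cast_sub h]
    exact_mod_cast this
  · rw [Nat.choose_eq_zero_of_lt h, Nat.choose_eq_zero_of_lt (by omega)]
    simp

theorem cast_choose_three (n : ℕ) : (n.choose 3 : ℚ) = n * (n - 1) * (n - 2) / 6 := by
  have := cast_choose_succ_mul n 2
  rw [Nat.cast_choose_two] at this
  push_cast at this
  linarith

theorem cast_choose_four (n : ℕ) : (n.choose 4 : ℚ) = n * (n - 1) * (n - 2) * (n - 3) / 24 := by
  have := cast_choose_succ_mul n 3
  rw [cast_choose_three] at this
  push_cast at this
  linarith

theorem signedBinomialSum_two (a b : ℕ) :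
    signedBinomialSum a b 2 = b * (b - 1) / 2 - a * b + a * (a - 1) / 2 := by
  simp [signedBinomialSum, Finset.Nat.antidiagonal_succ, Nat.cast_choose_two]
  ring

theorem signedBinomialSum_four (a b : ℕ) :
    signedBinomialSum a b 4 = b * (b - 1) * (b - 2) * (b - 3) / 24
      - a * (b * (b - 1) * (b - 2) / 6) + a * (a - 1) / 2 * (b * (b - 1) / 2)
      - a * (a - 1) * (a - 2) / 6 * b + a * (a - 1) * (a - 2) * (a - 3) / 24 := by
  simp [signedBinomialSum, Finset.Nat.antidiagonal_succ, Nat.cast_choose_two, cast_choose_three,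
    cast_choose_four]
  ring

end Binomial

/-! ### The explicit weight distributions -/

section Distribution

/-- With `p = 2 ^ q` every power of two in the statement is a monomial in `p`, so later identities
become polynomial ones. -/
theorem two_pow_values {m q : ℕ} (hm : m = 2 * q + 3) :
    2 ^ m = 8 * (2 ^ q) ^ 2 ∧ 2 ^ (m - 1) = 4 * (2 ^ q) ^ 2 ∧ 2 ^ ((m - 1) / 2) = 2 * 2 ^ q ∧
      2 ^ ((m - 3) / 2) = 2 ^ q ∧ 2 ^ (2 * m - 1) = 32 * (2 ^ q) ^ 4 ∧
      2 ^ (2 * m) = 64 * (2 ^ q) ^ 4 := by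
  have h1 : m - 1 = 2 * q + 2 := by omega
  have h2 : (m - 1) / 2 = q + 1 := by omega
  have h3 : (m - 3) / 2 = q := by omega
  have h4 : 2 * m - 1 = 4 * q + 5 := by omega
  have h5 : 2 * m = 4 * q + 6 := by omega
  rw [h2, h3, h4, h5, h1, hm]
  refine ⟨by ring, by ring, by ring, rfl, by ring, by ring⟩

/-- The reflection `k ↦ 2 * h - k` swaps `h - s` with `h + s` and 0 with `2 * h`, and fixes `h`; `0
< s < h` keeps these five weights distinct. -/
theorem add_reflected_three_weights {h s : ℕ} (hs : 0 < s) (hsh : s < h) (x y z k : ℕ) :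
    (if k = 0 then 1 else if k = h - s then x else if k = h then y else if k = h + s then z else 0)
      + (if k ≤ 2 * h then (if 2 * h - k = 0 then 1 else if 2 * h - k = h - s then x
          else if 2 * h - k = h then y else if 2 * h - k = h + s then z else 0) else 0)
      = if k = 0 then 1 else if k = h - s then x + z else if k = h then y + y
        else if k = h + s then x + z else if k = 2 * h then 1 else 0 := by
  split_ifs <;> omega

theorem sum_range_five_weights {M : Type*} [AddCommMonoid M] {h s : ℕ} (hs : 0 < s) (hsh : s < h)
    (u v : ℕ) (F : ℕ → M) :
    ∑ w ∈ Finset.range (2 * h + 1), (if w = 0 then 1 else if w = h - s then u else if w = h then v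
        else if w = h + s then u else if w = 2 * h then 1 else 0) • F w
      = F 0 + u • F (h - s) + v • F h + u • F (h + s) + F (2 * h) := by
  have h1 : ∀ w, (if w = 0 then 1 else if w = h - s then u else if w = h then v
        else if w = h + s then u else if w = 2 * h then 1 else 0)
      = (if w = 0 then 1 else 0) + (if w = h - s then u else 0) + (if w = h then v else 0)
        + (if w = h + s then u else 0) + (if w = 2 * h then 1 else 0) := by
    intro w
    split_ifs <;> omega
  simp_rw [h1, add_smul, Finset.sum_add_distrib, ite_smul, zero_smul, Finset.sum_ite_eq',
    one_smul, Finset.mem_range]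
  rw [if_pos (by omega), if_pos (by omega), if_pos (by omega), if_pos (by omega),
    if_pos (by omega)]

theorem extended_coefficients {p : ℕ} (hp : 1 ≤ p) :
    (8 * p ^ 2 - 1) * (2 * p + 1) * p + (8 * p ^ 2 - 1) * (2 * p - 1) * p = 32 * p ^ 4 - 4 * p ^ 2 ∧
      (8 * p ^ 2 - 1) * (4 * p ^ 2 + 1) + (8 * p ^ 2 - 1) * (4 * p ^ 2 + 1)
        = 64 * p ^ 4 + 8 * p ^ 2 - 2 := by
  have h1 : 1 ≤ p ^ 2 := Nat.one_le_pow _ _ hp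
  have h2 : p ^ 2 ≤ p ^ 4 := Nat.pow_le_pow_right hp (by norm_num)
  zify [show 1 ≤ 8 * p ^ 2 by omega, show 1 ≤ 2 * p by omega, show 4 * p ^ 2 ≤ 32 * p ^ 4 by omega,
    show 2 ≤ 64 * p ^ 4 + 8 * p ^ 2 by omega]
  exact ⟨by ring, by ring⟩

theorem card_fin_two_pow_sub_one_add_one (m : ℕ) : Fintype.card (Fin (2 ^ m - 1 + 1)) = 2 ^ m := by
  rw [Fintype.card_fin, Nat.sub_add_cancel Nat.one_le_two_pow]

variable {m : ℕ} {C : Submodule (ZMod 2) (Fin (2 ^ m - 1) → ZMod 2)}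

theorem exists_eq_two_mul_add_three (hm : 5 ≤ m) (hodd : Odd m) : ∃ q, m = 2 * q + 3 ∧ 1 ≤ q := by
  obtain ⟨r, hr⟩ := hodd
  exact ⟨r - 1, by omega, by omega⟩

theorem weightCount_dualCode_extendedCode_of_threeWeight (hm : 5 ≤ m) (hodd : Odd m)
    (hC : ∀ w : ℕ, weightCount (dualCode C) w = threeWeightDistribution m w) (k : ℕ) :
    weightCount (dualCode (extendedCode C)) k = extendedDualDistribution m k := by
  obtain ⟨q, hq, hq1⟩ := exists_eq_two_mul_add_three hm hodd
  obtain ⟨e1, e2, e3, e4, e5, e6⟩ := two_pow_values hq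
  have hp : 2 ≤ 2 ^ q := Nat.le_self_pow (by omega) 2
  rw [weightCount_dualCode_extendedCode, hC, hC]
  simp only [threeWeightDistribution, extendedDualDistribution]
  rw [Nat.sub_add_cancel Nat.one_le_two_pow, e1, e2, e3, e4, e5, e6]
  generalize 2 ^ q = p at hp
  obtain ⟨c1, c2⟩ := extended_coefficients (p := p) (by omega)
  rw [← c1, ← c2, show 8 * p ^ 2 = 2 * (4 * p ^ 2) by ring]
  exact add_reflected_three_weights (by omega) (by nlinarith) _ _ _ k

theorem sum_codewords_dualCode_extendedCode (hm : 5 ≤ m) (hodd : Odd m)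
    (hC : ∀ w : ℕ, weightCount (dualCode C) w = threeWeightDistribution m w)
    {M : Type*} [AddCommMonoid M] (F : ℕ → M) :
    ∑ e ∈ codewords (dualCode (extendedCode C)), F (hammingNorm e)
      = F 0 + (2 ^ (2 * m - 1) - 2 ^ (m - 1)) • F (2 ^ (m - 1) - 2 ^ ((m - 1) / 2))
        + (2 ^ (2 * m) + 2 ^ m - 2) • F (2 ^ (m - 1))
        + (2 ^ (2 * m - 1) - 2 ^ (m - 1)) • F (2 ^ (m - 1) + 2 ^ ((m - 1) / 2)) + F (2 ^ m) := by
  have h1 : 2 * 2 ^ (m - 1) = 2 ^ m := by rw [← pow_succ']; congr 1; omega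
  rw [sum_codewords_weight, card_fin_two_pow_sub_one_add_one]
  simp_rw [weightCount_dualCode_extendedCode_of_threeWeight hm hodd hC, extendedDualDistribution,
    ← h1]
  exact sum_range_five_weights (by positivity) (Nat.pow_lt_pow_right (by norm_num) (by omega)) _ _ F

theorem cast_coefficients (hm : 5 ≤ m) :
    ((2 ^ (2 * m - 1) - 2 ^ (m - 1) : ℕ) : ℚ) = 2 ^ (2 * m - 1) - 2 ^ (m - 1) ∧
      ((2 ^ (2 * m) + 2 ^ m - 2 : ℕ) : ℚ) = 2 ^ (2 * m) + 2 ^ m - 2 := by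
  have h1 : 2 ^ (m - 1) ≤ 2 ^ (2 * m - 1) := Nat.pow_le_pow_right (by norm_num) (by omega)
  have h2 : 2 ≤ 2 ^ m := Nat.le_self_pow (by omega) 2
  rw [Nat.cast_sub h1, Nat.cast_sub (le_add_left h2)]
  push_cast
  exact ⟨rfl, rfl⟩

theorem card_codewords_dualCode_extendedCode (hm : 5 ≤ m) (hodd : Odd m)
    (hC : ∀ w : ℕ, weightCount (dualCode C) w = threeWeightDistribution m w) :
    ((codewords (dualCode (extendedCode C))).card : ℚ) = 2 ^ (2 * m + 1) := by
  have h := sum_codewords_dualCode_extendedCode hm hodd hC (fun _ => (1 : ℚ))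
  have h1 : (2 : ℚ) * 2 ^ (m - 1) = 2 ^ m := by rw [← pow_succ']; congr 1; omega
  have h2 : (2 : ℚ) * 2 ^ (2 * m - 1) = 2 ^ (2 * m) := by rw [← pow_succ']; congr 1; omega
  obtain ⟨c1, c2⟩ := cast_coefficients hm
  simp only [nsmul_eq_mul, c1, c2, Finset.sum_const, mul_one] at h
  rw [h, pow_succ]
  linarith

/-- MacWilliams for the dual of the extended code, read off at `X ^ k`. Its words of weight 0 and `2
^ m` together yield the term `(1 + (-1) ^ k) * (2 ^ m).choose k`. -/
theorem weightCount_extendedCode_of_threeWeight (hm : 5 ≤ m) (hodd : Odd m)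
    (hC : ∀ w : ℕ, weightCount (dualCode C) w = threeWeightDistribution m w) (k : ℕ) :
    (weightCount (extendedCode C) k : ℚ) = extendedDistribution m k := by
  have hmac := card_mul_throughEnumerator_dualCode (E := dualCode (extendedCode C))
  rw [dualCode_dualCode, card_fin_two_pow_sub_one_add_one,
    sum_codewords_dualCode_extendedCode hm hodd hC
      (fun w => (1 - Polynomial.X : Polynomial ℚ) ^ w * (1 + Polynomial.X) ^ (2 ^ m - w))] at hmac
  have hk := congrArg (fun P => Polynomial.coeff P k) hmac
  have h1 : 2 * 2 ^ (m - 1) = 2 ^ m := by rw [← pow_succ']; congr 1; omega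
  have h2 : 2 ^ ((m - 1) / 2) < 2 ^ (m - 1) := Nat.pow_lt_pow_right (by norm_num) (by omega)
  have h3 : 0 < 2 ^ ((m - 1) / 2) := by positivity
  obtain ⟨c1, c2⟩ := cast_coefficients hm
  simp only [Polynomial.coeff_natCast_mul, coeff_throughEnumerator, throughCount_empty,
    Polynomial.coeff_add, Polynomial.coeff_smul, coeff_one_sub_X_pow_mul_one_add_X_pow] at hk
  rw [card_codewords_dualCode_extendedCode hm hodd hC, Nat.sub_zero, Nat.sub_self,
    show 2 ^ m - (2 ^ (m - 1) - 2 ^ ((m - 1) / 2)) = 2 ^ (m - 1) + 2 ^ ((m - 1) / 2) by omega,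
    show 2 ^ m - 2 ^ (m - 1) = 2 ^ (m - 1) by omega,
    show 2 ^ m - (2 ^ (m - 1) + 2 ^ ((m - 1) / 2)) = 2 ^ (m - 1) - 2 ^ ((m - 1) / 2) by omega,
    signedBinomialSum_zero_left, signedBinomialSum_zero_right, signedBinomialSum_self] at hk
  simp only [nsmul_eq_mul, c1, c2] at hk
  rw [extendedDistribution, eq_div_iff (by positivity), mul_comm, hk]
  ring

/-- After the substitution `p = 2 ^ q` both numerators vanish identically as polynomials in `p`. -/
theorem extendedDistribution_two_four (hm : 5 ≤ m) (hodd : Odd m) :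
    extendedDistribution m 2 = 0 ∧ extendedDistribution m 4 = 0 := by
  obtain ⟨q, hq, hq1⟩ := exists_eq_two_mul_add_three hm hodd
  obtain ⟨e1, e2, e3, -, e5, e6⟩ := two_pow_values hq
  have hp : 2 ≤ 2 ^ q := Nat.le_self_pow (by omega) 2
  have f1 : (2 : ℚ) ^ m = 8 * (2 ^ q) ^ 2 := by exact_mod_cast e1
  have f2 : (2 : ℚ) ^ (m - 1) = 4 * (2 ^ q) ^ 2 := by exact_mod_cast e2
  have f5 : (2 : ℚ) ^ (2 * m - 1) = 32 * (2 ^ q) ^ 4 := by exact_mod_cast e5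
  have f6 : (2 : ℚ) ^ (2 * m) = 64 * (2 ^ q) ^ 4 := by exact_mod_cast e6
  have f7 : ((2 ^ (m - 1) - 2 ^ ((m - 1) / 2) : ℕ) : ℚ) = 4 * (2 ^ q) ^ 2 - 2 * 2 ^ q := by
    rw [e2, e3, Nat.cast_sub (by nlinarith)]
    push_cast
    ring
  have f8 : ((2 ^ (m - 1) + 2 ^ ((m - 1) / 2) : ℕ) : ℚ) = 4 * (2 ^ q) ^ 2 + 2 * 2 ^ q := by
    rw [e2, e3]
    push_cast
    ring
  simp only [extendedDistribution, signedBinomialSum_two, signedBinomialSum_four, f7, f8,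
    cast_choose_four, Nat.cast_choose_two, Nat.choose_one_right, Nat.cast_pow, Nat.cast_ofNat,
    f1, f2, f5, f6, show 2 / 2 = 1 from rfl, show 4 / 2 = 2 from rfl, div_eq_zero_iff]
  exact ⟨Or.inl (by ring), Or.inl (by ring)⟩

theorem five_lt_hammingNorm_of_mem_extendedCode (hm : 5 ≤ m) (hodd : Odd m)
    (hC : ∀ w : ℕ, weightCount (dualCode C) w = threeWeightDistribution m w)
    {x : Fin (2 ^ m - 1 + 1) → ZMod 2} (hx : x ∈ extendedCode C) (hx0 : x ≠ 0) :
    5 < hammingNorm x := by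
  have heven := even_hammingNorm_of_mem_extendedCode hx
  have hpos := hammingNorm_pos_iff.2 hx0
  have hne : weightCount (extendedCode C) (hammingNorm x) ≠ 0 := by
    rw [weightCount_eq_card]
    exact Finset.card_ne_zero_of_mem (Finset.mem_filter.2 ⟨mem_codewords.2 hx, rfl⟩)
  obtain ⟨z2, z4⟩ := extendedDistribution_two_four hm hodd
  rw [← weightCount_extendedCode_of_threeWeight hm hodd hC, Nat.cast_eq_zero] at z2 z4
  by_contra hle
  have h24 : hammingNorm x = 2 ∨ hammingNorm x = 4 := by
    obtain ⟨r, hr⟩ := heven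
    omega
  rcases h24 with h | h
  · exact hne (by rw [h, z2])
  · exact hne (by rw [h, z4])

theorem throughCount_dualCode_extendedCode_eq (hm : 5 ≤ m) (hodd : Odd m)
    (hC : ∀ w : ℕ, weightCount (dualCode C) w = threeWeightDistribution m w)
    (w : ℕ) (T T' : Finset (Fin (2 ^ m - 1 + 1))) (hT : T.card = T'.card) (hT3 : T.card ≤ 3) :
    throughCount (dualCode (extendedCode C)) w T
      = throughCount (dualCode (extendedCode C)) w T' := by
  have h2 : 2 ^ ((m - 1) / 2) < 2 ^ (m - 1) := Nat.pow_lt_pow_right (by norm_num) (by omega)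
  have h3 : 0 < 2 ^ ((m - 1) / 2) := by positivity
  refine throughCount_eq_of_card_eq (w₁ := 2 ^ (m - 1) - 2 ^ ((m - 1) / 2)) (w₂ := 2 ^ (m - 1))
    (w₃ := 2 ^ (m - 1) + 2 ^ ((m - 1) / 2)) ?_ (by omega) (by omega) (by omega) ?_ hT hT3 w
  · rw [dualCode_dualCode]
    exact fun x hx hx0 => five_lt_hammingNorm_of_mem_extendedCode hm hodd hC hx hx0
  · intro w h0 h1 h2 h3 h4
    rw [card_fin_two_pow_sub_one_add_one] at h4
    rw [weightCount_dualCode_extendedCode_of_threeWeight hm hodd hC, extendedDualDistribution,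
      if_neg h0, if_neg h1, if_neg h2, if_neg h3, if_neg h4]

end Distribution

/-! ### The designs held by both codes -/

theorem mainTheorem2 (m : ℕ) (hm : 5 ≤ m) (hodd : Odd m)
    (C : Submodule (ZMod 2) (Fin (2 ^ m - 1) → ZMod 2))
    (hC : ∀ w : ℕ, weightCount (dualCode C) w = threeWeightDistribution m w) :
    (∀ k : ℕ, k ≤ 2 ^ m → (weightCount (extendedCode C) k : ℚ) = extendedDistribution m k) ∧
    (∀ k : ℕ, weightCount (dualCode (extendedCode C)) k = extendedDualDistribution m k) ∧
    (∀ k : ℕ, 1 ≤ k → weightCount (extendedCode C) k ≠ 0 →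
      ∃ l : ℕ,
        (l : ℚ) = (weightCount (extendedCode C) k : ℚ) * (k.choose 3 : ℚ)
          / ((2 ^ m).choose 3 : ℚ) ∧
        IsDesign 3 (2 ^ m) k l (weightSupports (extendedCode C) k)) ∧
    (∀ k : ℕ, 1 ≤ k → weightCount (dualCode (extendedCode C)) k ≠ 0 →
      ∃ l : ℕ,
        (l : ℚ) = (weightCount (dualCode (extendedCode C)) k : ℚ) * (k.choose 3 : ℚ)
          / ((2 ^ m).choose 3 : ℚ) ∧
        IsDesign 3 (2 ^ m) k l (weightSupports (dualCode (extendedCode C)) k)) := by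
  have hcard := card_fin_two_pow_sub_one_add_one m
  have hthrough := throughCount_dualCode_extendedCode_eq hm hodd hC
  refine ⟨fun k _ => weightCount_extendedCode_of_threeWeight hm hodd hC k,
    weightCount_dualCode_extendedCode_of_threeWeight hm hodd hC, fun k hk1 hk => ?_,
    fun k hk1 hk => ?_⟩
  · refine exists_isDesign_weightSupports hcard (by norm_num) ?_ hk fun T T' hT hT' => ?_
    · rw [weightCount_eq_card, ← Nat.pos_iff_ne_zero, Finset.card_pos] at hk
      obtain ⟨x, hx⟩ := hk
      obtain ⟨hxC, rfl⟩ := Finset.mem_filter.1 hx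
      have := five_lt_hammingNorm_of_mem_extendedCode hm hodd hC (mem_codewords.1 hxC)
        (hammingNorm_pos_iff.1 hk1)
      omega
    -- By biduality the extended code is the dual of the code whose counts are already known to be
    -- constant.
    · have := throughCount_dualCode_eq_of_card_eq hthrough hT hT' k
      rwa [dualCode_dualCode] at this
  · refine exists_isDesign_weightSupports hcard (by norm_num) ?_ hk fun T T' hT hT' =>
      hthrough k T T' (hT.trans hT'.symm) hT.le
    by_contra hk3
    obtain ⟨q, hq, hq1⟩ := exists_eq_two_mul_add_three hm hodd
    obtain ⟨e1, e2, e3, -, -, -⟩ := two_pow_values hq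
    have hp : 2 ≤ 2 ^ q := Nat.le_self_pow (by omega) 2
    -- The smallest positive weight `4 * p ^ 2 - 2 * p`, with `p = 2 ^ q ≥ 2`, is at least 3, which
    -- rules out `k = 1` and `k = 2`.
    have hlow : 2 * 2 ^ q + 3 ≤ 4 * (2 ^ q) ^ 2 := by nlinarith
    refine hk ?_
    rw [weightCount_dualCode_extendedCode_of_threeWeight hm hodd hC, extendedDualDistribution,
      e1, e2, e3, if_neg (by omega), if_neg (by omega), if_neg (by omega), if_neg (by omega),
      if_neg (by omega)]
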